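/- Let $B$ be a $C^*$-algebra (not necessarily unital), let $X$ be a (right) Hilbert $C^*$-module over $B$ with $B$-valued inner product $\langle\cdot,\cdot\rangle$, and let $M,N\subset X$ be complemented submodules, i.e. $X=M\oplus M^{\perp}=N\oplus N^{\perp}$, where $M^{\perp}=\{x\in X:\langle m,x\rangle=0\text{ for all }m\in M\}$. The pair $(M,N)$ is called concordant if $X=(M\cap N)\oplus\overline{M^{\perp}+N^{\perp}}$. For a representation $\pi:B\to\mathbb{B}(H_\pi)$ on a Hilbert space, let $X_\pi=X\otimes_B H_\pi$ be the Hilbert space completion of the tensor product with respect to $\langle x\otimes h,y\otimes k\rangle=\langle h,\pi(\langle x,y\rangle)k\rangle$ (after dividing out vectors of length zero), and for a closed submodule $\Omega\subset X$ let $\Omega_\pi=\Omega\otimes_B H_\pi\subset X_\pi$, i.e. the closed linear span of the elements $\omega\otimes h$ with $\omega\in\Omega$, $h\in H_\pi$. Then $(M,N)$ is concordant if and only if for every irreducible representation $\pi:B\to\mathbb{B}(H_\pi)$ there is an equality of closed subspaces $M_\pi\cap N_\pi=(M\cap N)_\pi$ of $X_\pi$. -/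

import Mathlib

universe u v w

open scoped TensorProduct InnerProductSpace ComplexConjugate

namespace HilbertModule

/-! Throughout, `B` is a (not necessarily unital) C⋆-algebra and `X` is a right Hilbert
C⋆-module over `B`.  Mathlib's `CStarModule A X` satisfies `⟪x, a • y⟫ = a * ⟪x, y⟫`, so right
Hilbert `B`-modules are exactly the complete instances of `CStarModule Bᵐᵒᵖ X`: the right action
is `x · b = op b • x` and the `B`-valued inner product is `unop ⟪x, y⟫`, which is conjugate-linear
in `x`, satisfies `⟨x, y · b⟩ = ⟨x, y⟩ b`, and induces the norm of `X`.  (The module axioms for the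
action of `B` follow from the axioms of the inner product.) -/

section Submodules

variable (B : Type*) [NonUnitalCStarAlgebra B] [PartialOrder B]
  {X : Type*} [NormedAddCommGroup X] [NormedSpace ℂ X] [SMul Bᵐᵒᵖ X] [CStarModule Bᵐᵒᵖ X]

/-- The `B`-valued inner product of a right Hilbert `B`-module. -/
def binner (x y : X) : B := MulOpposite.unop (inner Bᵐᵒᵖ x y)

variable {B} in
lemma binner_add_left (x y z : X) : binner B (x + y) z = binner B x z + binner B y z := by
  simp [binner]

variable {B} in
lemma binner_add_right (x y z : X) : binner B x (y + z) = binner B x y + binner B x z := by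
  simp [binner]

variable {B} in
lemma binner_smul_left (c : ℂ) (x y : X) : binner B (c • x) y = conj c • binner B x y := by
  simp [binner]

variable {B} in
lemma binner_smul_right (c : ℂ) (x y : X) : binner B x (c • y) = c • binner B x y := by
  simp [binner]

variable {B} in
lemma star_binner (x y : X) : star (binner B x y) = binner B y x := by
  simp [binner, ← MulOpposite.unop_star]

variable {B} in
/-- `⟨x, y · b⟩ = ⟨x, y⟩ b`. -/
lemma binner_act_right (x y : X) (b : B) :
    binner B x (MulOpposite.op b • y) = binner B x y * b := by
  simp [binner]

variable {B} in
/-- `⟨x · b, y⟩ = b⋆ ⟨x, y⟩`. -/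
lemma binner_act_left (x y : X) (b : B) :
    binner B (MulOpposite.op b • x) y = star b * binner B x y := by
  rw [← star_binner, binner_act_right, star_mul, star_binner]

variable {B} in
lemma binner_sum_left {ι : Type*} (s : Finset ι) (f : ι → X) (y : X) :
    binner B (∑ i ∈ s, f i) y = ∑ i ∈ s, binner B (f i) y := by
  simp [binner]

variable {B} in
lemma binner_sum_right {ι : Type*} (s : Finset ι) (x : X) (f : ι → X) :
    binner B x (∑ i ∈ s, f i) = ∑ i ∈ s, binner B x (f i) := by
  simp [binner]

variable {B} in
lemma binner_self_nonneg (x : X) : 0 ≤ binner B x x :=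
  CStarModule.inner_self_nonneg (A := Bᵐᵒᵖ) (x := x)

/-- The orthogonal complement `Mᗮ = {x | ⟨m, x⟩ = 0 for all m ∈ M}`. -/
def orthogonal (M : Submodule ℂ X) : Submodule ℂ X where
  carrier := {x | ∀ m ∈ M, binner B m x = 0}
  add_mem' hx hy m hm := by simp [binner_add_right, hx m hm, hy m hm]
  zero_mem' m _ := by simp [binner]
  smul_mem' c x hx m hm := by simp [binner_smul_right, hx m hm]

/-- `M` is a complemented submodule of `X`: it is a `B`-submodule and `X = M ⊕ Mᗮ`.
(Such an `M` is automatically closed.) -/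
structure IsComplemented (M : Submodule ℂ X) : Prop where
  act_mem : ∀ (b : B) (x : X), x ∈ M → MulOpposite.op b • x ∈ M
  isCompl : IsCompl M (orthogonal B M)

/-- The pair `(M, N)` is concordant: `X` is the direct sum of `M ∩ N` and the closure of
`Mᗮ + Nᗮ`. -/
def IsConcordant (M N : Submodule ℂ X) : Prop :=
  IsCompl (M ⊓ N) (orthogonal B M ⊔ orthogonal B N).topologicalClosure

end Submodules

section Representations

variable {B : Type*} [NonUnitalCStarAlgebra B]
  {H : Type*} [NormedAddCommGroup H] [InnerProductSpace ℂ H] [CompleteSpace H]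

/-- A representation `π` of `B` on the Hilbert space `H` is irreducible: it is nonzero and the
only closed subspaces of `H` invariant under `π(B)` are `0` and `H`. -/
structure IsIrreducible (π : B →⋆ₙₐ[ℂ] (H →L[ℂ] H)) : Prop where
  ne_zero : π ≠ 0
  eq_bot_or_eq_top : ∀ K : Submodule ℂ H, IsClosed (K : Set H) →
    (∀ (b : B), ∀ h ∈ K, π b h ∈ K) → K = ⊥ ∨ K = ⊤

end Representations

section Gram

variable {B : Type*} [NonUnitalCStarAlgebra B] [PartialOrder B] [StarOrderedRing B]
  {X : Type*} [NormedAddCommGroup X] [NormedSpace ℂ X] [SMul Bᵐᵒᵖ X] [CStarModule Bᵐᵒᵖ X]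

lemma exists_eq_star_mul_self {A : Type*} [NonUnitalCStarAlgebra A] [PartialOrder A]
    [StarOrderedRing A] {a : A} (ha : 0 ≤ a) : ∃ d : A, a = star d * d :=
  (CStarAlgebra.nonneg_iff_eq_star_mul_self).1 ha

lemma exists_neg_witness {A : Type*} [NonUnitalCStarAlgebra A] [PartialOrder A]
    [StarOrderedRing A] (g : A) (hg : IsSelfAdjoint g) :
    ∃ c : A, 0 ≤ c ∧ star c * g * c = -(c * c * c) ∧ (c = 0 → 0 ≤ g) := by
  have hcs : star g⁻ = g⁻ := (IsSelfAdjoint.of_nonneg (CFC.negPart_nonneg g)).star_eq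
  refine ⟨g⁻, CFC.negPart_nonneg g, ?_, (CFC.negPart_eq_zero_iff g hg).1⟩
  have h : g⁻ * g = -(g⁻ * g⁻) := by
    conv_lhs => rw [← CFC.posPart_sub_negPart g hg]
    rw [CFC.posPart_sub_negPart g hg, ← sub_eq_zero, sub_neg_eq_add, ← mul_add]
    conv_lhs => enter [2, 1]; rw [← CFC.posPart_sub_negPart g hg]
    rw [sub_add_cancel, CFC.negPart_mul_posPart]
  rw [hcs, h, neg_mul]

/-- The Gram matrix of a finite family in a Hilbert module is of the form `d⋆ d`. -/
lemma exists_gram_factor {n : ℕ} (x : Fin n → X) :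
    ∃ d : CStarMatrix (Fin n) (Fin n) B,
      ∀ i j, binner B (x i) (x j) = ∑ k, star (d k i) * d k j := by
  let G : CStarMatrix (Fin n) (Fin n) B :=
    CStarMatrix.ofMatrix (fun i j => binner B (x i) (x j))
  have hGa : ∀ i j, G i j = binner B (x i) (x j) := fun i j => rfl
  have hG : IsSelfAdjoint G := by
    ext i j
    simp [CStarMatrix.star_apply, hGa, star_binner]
  obtain ⟨c, hc0, h1, hcG⟩ := exists_neg_witness G hG
  have hcs : star c = c := (IsSelfAdjoint.of_nonneg hc0).star_eq
  have h3 : 0 ≤ c * c * c := by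
    have := star_left_conjugate_nonneg hc0 c
    rwa [hcs] at this
  obtain ⟨e, he⟩ := exists_eq_star_mul_self h3
  have hdiag : ∀ k, (star c * G * c) k k =
      binner B (∑ j, MulOpposite.op (c j k) • x j) (∑ j, MulOpposite.op (c j k) • x j) := by
    intro k
    simp only [CStarMatrix.mul_apply, CStarMatrix.star_apply, binner_sum_left, binner_sum_right,
      binner_act_left, binner_act_right, hGa, Finset.sum_mul]
  have he0 : e = 0 := by
    ext l k
    have h5 : 0 ≤ -((star e * e) k k) := by
      rw [← he, ← CStarMatrix.neg_apply, ← h1, hdiag]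
      exact binner_self_nonneg _
    rw [CStarMatrix.mul_apply] at h5
    have h6 : ∀ m ∈ Finset.univ, 0 ≤ (star e) k m * e m k := fun m _ => by
      rw [CStarMatrix.star_apply]; exact star_mul_self_nonneg _
    have h7 : ∑ m, (star e) k m * e m k = 0 :=
      le_antisymm (neg_nonneg.1 h5) (Finset.sum_nonneg h6)
    have h8 := (Finset.sum_eq_zero_iff_of_nonneg h6).1 h7 l (Finset.mem_univ _)
    rw [CStarMatrix.star_apply] at h8
    simpa using CStarRing.star_mul_self_eq_zero_iff _ |>.1 h8
  have hc3 : c * c * c = 0 := by rw [he, he0]; simp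
  have hcz : c = 0 := by
    have h9 : star (c * c) * (c * c) = 0 := by
      rw [star_mul, hcs, ← mul_assoc, hc3, zero_mul]
    have h10 := CStarRing.star_mul_self_eq_zero_iff _ |>.1 h9
    exact CStarRing.star_mul_self_eq_zero_iff _ |>.1 (by rw [hcs]; exact h10)
  have hGnn : 0 ≤ G := hcG hcz
  obtain ⟨d, hd⟩ := exists_eq_star_mul_self hGnn
  refine ⟨d, fun i j => ?_⟩
  rw [← hGa, hd, CStarMatrix.mul_apply]
  simp [CStarMatrix.star_apply]

end Gram

section Localisation

variable {B : Type*} [NonUnitalCStarAlgebra B] [PartialOrder B] [StarOrderedRing B]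
  (X : Type*) [NormedAddCommGroup X] [NormedSpace ℂ X] [SMul Bᵐᵒᵖ X] [CStarModule Bᵐᵒᵖ X]
  {H : Type*} [NormedAddCommGroup H] [InnerProductSpace ℂ H] [CompleteSpace H]
  (π : B →⋆ₙₐ[ℂ] (H →L[ℂ] H))

/-- The sesquilinear form on `X ⊗ H` with `⟪x ⊗ h, y ⊗ k⟫ = ⟪h, π(⟨x, y⟩) k⟫`. -/
noncomputable def locForm : (X ⊗[ℂ] H) →ₗ⋆[ℂ] (X ⊗[ℂ] H) →ₗ[ℂ] ℂ :=
  TensorProduct.lift <| LinearMap.mk₂'ₛₗ (starRingEnd ℂ) (starRingEnd ℂ)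
    (fun x h => TensorProduct.lift <| LinearMap.mk₂ ℂ
      (fun y k => ⟪h, π (binner B x y) k⟫_ℂ)
      (by intro y z k; simp [binner_add_right])
      (by intro c y k; simp [binner_smul_right])
      (by intro y k l; simp)
      (by intro c y k; simp))
    (by intro x y h; ext; simp [binner_add_left])
    (by intro c x h; ext; simp [binner_smul_left])
    (by intro x h k; ext; simp)
    (by intro c x h; ext; simp [mul_comm])

@[simp]
lemma locForm_tmul (x y : X) (h k : H) :
    locForm X π (x ⊗ₜ h) (y ⊗ₜ k) = ⟪h, π (binner B x y) k⟫_ℂ := rfl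

lemma conj_locForm (s t : X ⊗[ℂ] H) : conj (locForm X π t s) = locForm X π s t := by
  induction s using TensorProduct.induction_on with
  | zero => simp
  | add a b ha hb => simp [ha, hb]
  | tmul x h =>
    induction t using TensorProduct.induction_on with
    | zero => simp
    | add a b ha hb => simp [ha, hb]
    | tmul y k =>
      rw [locForm_tmul, locForm_tmul, inner_conj_symm, ← star_binner, map_star,
        ContinuousLinearMap.star_eq_adjoint, ContinuousLinearMap.adjoint_inner_left]

lemma locForm_self_nonneg (t : X ⊗[ℂ] H) : 0 ≤ RCLike.re (locForm X π t t) := by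
  obtain ⟨n, x, h, rfl⟩ := TensorProduct.exists_sum_tmul_eq t
  obtain ⟨d, hd⟩ := exists_gram_factor (B := B) x
  have key : locForm X π (∑ j, x j ⊗ₜ[ℂ] h j) (∑ j, x j ⊗ₜ[ℂ] h j)
      = ∑ k, ⟪∑ i, π (d k i) (h i), ∑ j, π (d k j) (h j)⟫_ℂ := by
    simp only [map_sum, LinearMap.sum_apply, locForm_tmul, hd, _root_.sum_apply,
      inner_sum, sum_inner, map_mul, map_star, ContinuousLinearMap.star_eq_adjoint,
      ContinuousLinearMap.mul_def, ContinuousLinearMap.comp_apply, ContinuousLinearMap.adjoint_inner_right]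
    calc _ = ∑ j, ∑ k, ∑ i, ⟪π (d k i) (h i), π (d k j) (h j)⟫_ℂ :=
          Finset.sum_congr rfl fun j _ => Finset.sum_comm
      _ = ∑ k, ∑ j, ∑ i, ⟪π (d k i) (h i), π (d k j) (h j)⟫_ℂ := Finset.sum_comm
  rw [key, map_sum]
  exact Finset.sum_nonneg fun k _ => inner_self_nonneg

/-- The algebraic tensor product `X ⊗ H`, to be endowed with the semi-inner product `locForm`
determined by `π`. -/
@[nolint unusedArguments]
def PreLoc (_π : B →⋆ₙₐ[ℂ] (H →L[ℂ] H)) : Type _ := X ⊗[ℂ] H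

instance : AddCommGroup (PreLoc X π) := inferInstanceAs (AddCommGroup (X ⊗[ℂ] H))
instance : Module ℂ (PreLoc X π) := inferInstanceAs (Module ℂ (X ⊗[ℂ] H))

/-- The semi-inner product on `X ⊗ H`. -/
noncomputable abbrev preLocCore : PreInnerProductSpace.Core ℂ (PreLoc X π) where
  inner s t := locForm X π s t
  conj_inner_symm := conj_locForm X π
  re_inner_nonneg := locForm_self_nonneg X π
  add_left r s t := LinearMap.map_add₂ (locForm X π) r s t
  smul_left s t c := LinearMap.map_smulₛₗ₂ (locForm X π) c s t

noncomputable instance : SeminormedAddCommGroup (PreLoc X π) :=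
  InnerProductSpace.Core.toSeminormedAddCommGroup (c := preLocCore X π)

noncomputable instance : InnerProductSpace ℂ (PreLoc X π) :=
  InnerProductSpace.ofCore (preLocCore X π)

/-- The localisation `X_π = X ⊗_B H`: the Hilbert space obtained from `X ⊗ H` by dividing out the
vectors of length zero and completing. (The vectors `x · b ⊗ h - x ⊗ π(b) h` have length zero,
so this is the completion of the `B`-balanced tensor product, see `tmul_balanced`.) -/
abbrev Loc : Type _ := UniformSpace.Completion (PreLoc X π)

variable {X}

/-- The elementary tensor `x ⊗ h` in `X ⊗_B H`. -/
noncomputable def tmul (x : X) (h : H) : Loc X π :=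
  ((show PreLoc X π from x ⊗ₜ[ℂ] h : PreLoc X π) : Loc X π)

lemma inner_tmul (x y : X) (h k : H) :
    ⟪tmul π x h, tmul π y k⟫_ℂ = ⟪h, π (binner B x y) k⟫_ℂ :=
  UniformSpace.Completion.inner_coe _ _

lemma tmul_balanced (x : X) (b : B) (h : H) :
    tmul π (MulOpposite.op b • x) h = tmul π x (π b h) := by
  rw [← sub_eq_zero, ← inner_self_eq_zero (𝕜 := ℂ)]
  simp only [inner_sub_left, inner_sub_right, inner_tmul, binner_act_left, binner_act_right,
    map_mul, map_star, ContinuousLinearMap.star_eq_adjoint, ContinuousLinearMap.mul_def, ContinuousLinearMap.comp_apply,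
    ContinuousLinearMap.adjoint_inner_right]
  simp

/-- The localisation `M_π = M ⊗_B H ⊆ X ⊗_B H` of a submodule `M` of `X`: the closed linear span of
the elementary tensors `m ⊗ h` with `m ∈ M` and `h ∈ H`. -/
noncomputable def locSubmodule (M : Submodule ℂ X) : Submodule ℂ (Loc X π) :=
  (Submodule.span ℂ {t | ∃ m ∈ M, ∃ h : H, tmul π m h = t}).topologicalClosure

end Localisation

end HilbertModule

/-! Localisation turns orthogonal decompositions of `X` into orthogonal decompositions of Hilbert
spaces. If `M ⊔ Mᗮ = ⊤`, then `M_π` is the orthogonal complement of `(Mᗮ)_π`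
(`locSubmodule_eq_orthogonal`). Hence a vector `b` of `X_π` orthogonal to `(Mᗮ)_π` and `(Nᗮ)_π` is
the same as a vector of `M_π ∩ N_π`.

If the pair is concordant, the part of a vector of `M_π ∩ N_π` orthogonal to `(M ∩ N)_π` is
orthogonal to `x ⊗ h` for all `x` in `M ∩ N` and in the closure of `Mᗮ + Nᗮ`, hence for all `x`, and
vanishes.

Conversely, put `Z = (M ∩ N) + closure (Mᗮ + Nᗮ)`, which is closed because its summands are closed
and orthogonal. If `Z ≠ X`, some irreducible `π` has `Z_π ≠ X_π`
(`exists_irreducible_locSubmodule_ne_top`). A vector orthogonal to `Z_π` lies in `M_π ∩ N_π = (M ∩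
N)_π ⊆ Z_π`, so it is zero, a contradiction.

The core is the detection of a proper closed submodule `Z`. For `x ∉ Z` at distance `d`, consider
the states `φ` of the unitization of `B` with `φ ⟨x - z, x - z⟩ ≥ d²` for all `z ∈ Z`. They form a
nonempty compact extreme subset of the state space (`separatingStates_nonempty`,
`isExtreme_separatingStates`), so by Krein–Milman one of them is pure. In its GNS representation,
with cyclic vector `Ω`, the vector `x ⊗ Ω` stays at distance at least `d` from `Z ⊗ Ω`, which is
dense in `Z_π`. Both properties rest on `exists_forall_stateSq_sub_le`: finitely many approximants
of `x` in `Z` can be replaced by one that is almost as good for every state at once. -/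

namespace HilbertModule

/-! ### States of a unital C⋆-algebra. -/

section States

variable (A : Type*) [CStarAlgebra A]

/-- The state space of a unital C⋆-algebra, as a set of functions: the contractive linear
functionals `φ` with `φ 1 = 1`. These are automatically positive. -/
def stateSpace : Set (A → ℂ) :=
  {φ | (∀ a b, φ (a + b) = φ a + φ b) ∧ (∀ (c : ℂ) a, φ (c • a) = c * φ a) ∧
    (∀ a, ‖φ a‖ ≤ ‖a‖) ∧ φ 1 = 1}

lemma isCompact_stateSpace : IsCompact (stateSpace A) := by
  refine (isCompact_univ_pi fun a : A => isCompact_closedBall (0 : ℂ) ‖a‖).of_isClosed_subset ?_ ?_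
  · simp only [stateSpace, Set.ofPred_and, Set.ofPred_forall]
    refine .inter (isClosed_iInter fun a => isClosed_iInter fun b => ?_) (.inter
      (isClosed_iInter fun c => isClosed_iInter fun a => ?_) (.inter
      (isClosed_iInter fun a => ?_) ?_))
    · exact isClosed_eq (by fun_prop) (by fun_prop)
    · exact isClosed_eq (by fun_prop) (by fun_prop)
    · exact isClosed_le (by fun_prop) (by fun_prop)
    · exact isClosed_eq (by fun_prop) (by fun_prop)
  · rintro φ ⟨-, -, h, -⟩ a -
    simpa using h a

variable {A}

/-- A state, as a linear functional. -/
def stateLinearMap {φ : A → ℂ} (hφ : φ ∈ stateSpace A) : A →ₗ[ℂ] ℂ where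
  toFun := φ
  map_add' := hφ.1
  map_smul' := hφ.2.1

/-- Adding `it` to `a` shifts the imaginary part of `φ a` by `t`, whereas `‖a + it‖² ≤ ‖a‖² + t²`.
The cross term `2t · Im (φ a)` must therefore stay bounded in `t`. -/
lemma im_state_eq_zero {φ : A → ℂ} (hφ : φ ∈ stateSpace A) {a : A} (ha : IsSelfAdjoint a) :
    (φ a).im = 0 := by
  obtain ⟨hadd, hsmul, hle, h1⟩ := hφ
  have key : ∀ t : ℝ, ((φ a).im + t) ^ 2 ≤ ‖a‖ ^ 2 + t ^ 2 := by
    intro t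
    set x : A := a + (t * Complex.I : ℂ) • 1
    have hx : φ x = φ a + t * Complex.I := by simp [x, hadd, hsmul, h1]
    have hn : ‖x‖ ^ 2 ≤ ‖a‖ ^ 2 + t ^ 2 := by
      rw [sq, ← CStarRing.norm_star_mul_self]
      have : star x * x = a * a + ((t ^ 2 : ℝ) : ℂ) • (1 : A) := by
        simp only [x, star_add, star_smul, ha.star_eq, star_one, add_mul, mul_add, smul_mul_assoc,
          mul_smul_comm, mul_one, one_mul, smul_add, smul_smul]
        have h2 : star (t * Complex.I : ℂ) = -(t * Complex.I) := by simp
        have h3 : (t * Complex.I) * -(t * Complex.I) = (((t ^ 2 : ℝ) : ℂ)) := by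
          push_cast
          linear_combination (-(t : ℂ) ^ 2) * Complex.I_sq
        rw [h2, h3, neg_smul]
        abel
      rw [this]
      refine (norm_add_le _ _).trans (add_le_add ?_ ?_)
      · rw [sq]
        exact norm_mul_le _ _
      · rw [norm_smul]
        rcases subsingleton_or_nontrivial A with h | h
        · rw [Subsingleton.elim (1 : A) 0]
          simp
          positivity
        · simp
    have him : |(φ x).im| ≤ ‖x‖ := (Complex.abs_im_le_norm _).trans (hle x)
    have : (φ x).im = (φ a).im + t := by simp [hx]
    rw [this] at him
    calc ((φ a).im + t) ^ 2 = |(φ a).im + t| ^ 2 := (sq_abs _).symm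
      _ ≤ ‖x‖ ^ 2 := by gcongr
      _ ≤ _ := hn
  by_contra hne
  -- This `t` makes the cross term equal to `‖a‖² + 1`, which exceeds the bound.
  have h := key ((‖a‖ ^ 2 + 1) / (2 * (φ a).im))
  have h2 : 2 * (φ a).im * ((‖a‖ ^ 2 + 1) / (2 * (φ a).im)) = ‖a‖ ^ 2 + 1 := by
    field_simp
  nlinarith [sq_nonneg (φ a).im]

variable [PartialOrder A] [StarOrderedRing A]

lemma norm_norm_smul_one_sub_le {a : A} (ha : 0 ≤ a) : ‖((‖a‖ : ℝ) : ℂ) • (1 : A) - a‖ ≤ ‖a‖ := by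
  have h : a ≤ ((‖a‖ : ℝ) : ℂ) • (1 : A) := by
    have := IsSelfAdjoint.le_algebraMap_norm_self (.of_nonneg ha)
    rwa [Algebra.algebraMap_eq_smul_one, ← Complex.coe_smul] at this
  rw [CStarAlgebra.norm_le_iff_le_algebraMap _ (norm_nonneg a) (sub_nonneg.2 h),
    Algebra.algebraMap_eq_smul_one, ← Complex.coe_smul]
  exact sub_le_self _ ha

-- The element `‖a‖ - a` has norm at most `‖a‖`, so `φ a` lies in the disc of radius `‖a‖` about
-- `‖a‖`, and its real part is nonnegative.
open scoped ComplexOrder in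
lemma state_nonneg {φ : A → ℂ} (hφ : φ ∈ stateSpace A) {a : A} (ha : 0 ≤ a) : 0 ≤ φ a := by
  have him := im_state_eq_zero hφ (.of_nonneg ha)
  rw [Complex.nonneg_iff]
  refine ⟨?_, him.symm⟩
  have h : φ (((‖a‖ : ℝ) : ℂ) • (1 : A) - a) = ‖a‖ - φ a := by
    have := map_sub (stateLinearMap hφ) (((‖a‖ : ℝ) : ℂ) • (1 : A)) a
    rw [map_smul] at this
    simpa [stateLinearMap, hφ.2.2.2] using this
  have h2 := (hφ.2.2.1 _).trans (norm_norm_smul_one_sub_le ha)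
  rw [h] at h2
  have h3 := (Complex.re_le_norm _).trans h2
  simp at h3
  exact h3

lemma norm_one_add_of_nonneg [Nontrivial A] {a : A} (ha : 0 ≤ a) : ‖1 + a‖ = 1 + ‖a‖ := by
  refine le_antisymm ((norm_add_le _ _).trans (by simp)) ?_
  have h1 := CStarAlgebra.norm_mem_spectrum_of_nonneg ha
  have h2 : 1 + ‖a‖ ∈ spectrum ℝ (1 + a) := by
    rw [add_comm 1 ‖a‖]
    simpa using! (spectrum.add_mem_add_iff (r := (‖a‖ : ℝ)) (s := (1 : ℝ)) (a := a)).2 h1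
  have h3 := spectrum.norm_le_norm_of_mem h2
  rwa [Real.norm_of_nonneg (by positivity)] at h3

/-- Hahn–Banach is applied to `1 + a` rather than to `a`: since `‖1 + a‖ = 1 + ‖a‖`, a norming
functional must attain its bound at `1` and at `a` simultaneously, and so is a state. -/
lemma exists_state_apply_eq_norm [Nontrivial A] {a : A} (ha : 0 ≤ a) :
    ∃ φ ∈ stateSpace A, φ a = ‖a‖ := by
  obtain ⟨f, hf, hfa⟩ := exists_dual_vector'' ℂ (1 + a)
  have hle : ∀ x, ‖f x‖ ≤ ‖x‖ := fun x => (f.le_opNorm x).trans (by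
    nlinarith [norm_nonneg x])
  have h1 : ‖f 1‖ ≤ 1 := (hle 1).trans (by simp)
  rw [norm_one_add_of_nonneg ha, map_add] at hfa
  have hre : (f 1).re + (f a).re = 1 + ‖a‖ := by simpa using congrArg Complex.re hfa
  have hr1 := Complex.re_le_norm (f 1)
  have hra := (Complex.re_le_norm (f a)).trans (hle a)
  have e1 : (f 1).re = 1 := by linarith
  have e2 : f 1 = 1 := by
    have h3 : ‖f 1‖ ^ 2 ≤ 1 := by nlinarith [norm_nonneg (f 1)]
    rw [← Complex.normSq_eq_norm_sq, Complex.normSq_apply, e1] at h3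
    have : (f 1).im = 0 := by nlinarith
    exact Complex.ext (by simp [e1]) (by simp [this])
  refine ⟨f, ⟨map_add f, fun c x => by simp, hle, e2⟩, ?_⟩
  rw [e2] at hfa
  push_cast at hfa
  exact add_left_cancel hfa

end States


/-! ### Pure states, irreducibility and the GNS construction. -/

section PureStates

variable {A : Type u} [CStarAlgebra A] {H : Type v} [NormedAddCommGroup H]
  [InnerProductSpace ℂ H] [CompleteSpace H]

lemma vectorState_mem_stateSpace (π : A →⋆ₐ[ℂ] (H →L[ℂ] H)) {v : H} (hv : v ≠ 0) :
    (fun a => ((‖v‖ ^ 2)⁻¹ : ℂ) * ⟪v, π a v⟫_ℂ) ∈ stateSpace A := by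
  have hv2 : (‖v‖ : ℂ) ≠ 0 := by simpa using hv
  refine ⟨fun a b => by simp [mul_add], fun c a => ?_, fun a => ?_, ?_⟩
  · simp only [map_smul, _root_.smul_apply, inner_smul_right]
    ring
  · have h1 : ‖⟪v, π a v⟫_ℂ‖ ≤ ‖v‖ * (‖a‖ * ‖v‖) :=
      (norm_inner_le_norm _ _).trans (by
        gcongr
        exact ((π a).le_opNorm v).trans (by
          gcongr
          exact NonUnitalStarAlgHom.norm_apply_le π a))
    have : 0 < ‖v‖ := norm_pos_iff.2 hv
    simp only [norm_mul, norm_inv, norm_pow, Complex.norm_real, norm_norm]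
    rw [inv_mul_le_iff₀ (by positivity)]
    linarith
  · simp only [map_one, one_apply_eq_self, inner_self_eq_norm_sq_to_K]
    exact inv_mul_cancel₀ (pow_ne_zero 2 hv2)

/-- If a pure state is implemented by a cyclic vector of a representation, then the representation
is irreducible. -/
lemma eq_bot_or_eq_top_of_mem_extremePoints (π : A →⋆ₐ[ℂ] (H →L[ℂ] H)) {Ω : H}
    (hΩ : DenseRange fun a => π a Ω)
    (hφ : (fun a => ⟪Ω, π a Ω⟫_ℂ) ∈ (stateSpace A).extremePoints ℝ)
    (K : Submodule ℂ H) (hK : IsClosed (K : Set H)) (hinv : ∀ a, ∀ h ∈ K, π a h ∈ K) :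
    K = ⊥ ∨ K = ⊤ := by
  have : CompleteSpace K := hK.completeSpace_coe
  have hinv' : ∀ a, ∀ h ∈ Kᗮ, π a h ∈ Kᗮ := by
    intro a h hh k hk
    have := hh (π (star a) k) (hinv _ _ hk)
    rwa [map_star, ContinuousLinearMap.star_eq_adjoint,
      ContinuousLinearMap.adjoint_inner_left] at this
  have hcyc : ∀ v : H, (∀ a, ⟪v, π a Ω⟫_ℂ = 0) → v = 0 := fun v hv => by
    have : (fun x => ⟪v, x⟫_ℂ) = fun _ => 0 :=
      hΩ.equalizer (by fun_prop) (by fun_prop) (funext hv)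
    exact inner_self_eq_zero.1 (congrFun this v)
  have htop : Ω ∈ K → K = ⊤ := fun h => by
    rw [eq_top_iff]
    intro x _
    exact (closure_minimal (Set.range_subset_iff.2 fun a => hinv a _ h) hK) (hΩ x)
  obtain ⟨p, hp, q, hq, hpq⟩ : ∃ p ∈ K, ∃ q ∈ Kᗮ, Ω = p + q :=
    ⟨_, K.starProjection_apply_mem Ω, _, K.sub_starProjection_mem_orthogonal Ω, by abel⟩
  by_cases hp0 : p = 0
  · left
    rw [eq_bot_iff]
    intro k hk
    have hΩK : Ω ∈ Kᗮ := by rw [hpq, hp0, zero_add]; exact hq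
    exact hcyc k fun a => hinv' a Ω hΩK k hk
  right
  by_cases hq0 : q = 0
  · exact htop (by rw [hpq, hq0, add_zero]; exact hp)
  have hcross : ∀ a, ⟪p, π a q⟫_ℂ = 0 := fun a => hinv' a q hq p hp
  have hcross' : ∀ a, ⟪q, π a p⟫_ℂ = 0 := fun a =>
    Submodule.inner_left_of_mem_orthogonal (hinv a p hp) hq
  -- Invariance of `K` and `Kᗮ` kills the cross terms, so the state is a convex combination of the
  -- normalised vector states of `p` and `q`, with weights `‖p‖²` and `‖q‖²`.
  have hsum : ∀ a, ⟪Ω, π a Ω⟫_ℂ = ⟪p, π a p⟫_ℂ + ⟪q, π a q⟫_ℂ := fun a => by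
    simp [hpq, hcross, hcross']
  have hp2 : 0 < ‖p‖ := norm_pos_iff.2 hp0
  have hq2 : 0 < ‖q‖ := norm_pos_iff.2 hq0
  have hp3 : (‖p‖ : ℂ) ≠ 0 := by simpa using hp0
  have hq3 : (‖q‖ : ℂ) ≠ 0 := by simpa using hq0
  have hone : ‖p‖ ^ 2 + ‖q‖ ^ 2 = 1 := by
    have h := (hsum 1).symm.trans hφ.1.2.2.2
    simp only [map_one, one_apply_eq_self, inner_self_eq_norm_sq_to_K] at h
    exact Complex.ofReal_injective (by push_cast; exact h)
  have hext := hφ.2 (vectorState_mem_stateSpace π hp0) (vectorState_mem_stateSpace π hq0)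
    ⟨‖p‖ ^ 2, ‖q‖ ^ 2, by positivity, by positivity, hone, by
      ext a
      simp only [Pi.add_apply, Pi.smul_apply, Complex.real_smul, hsum]
      push_cast
      field_simp⟩
  -- By extremality the normalised vector state of `p` is the given one, so `p` and `‖p‖² Ω` have
  -- the same inner products with the cyclic orbit. Thus `Ω` is a multiple of `p ∈ K`.
  have hpΩ : p - ((‖p‖ ^ 2 : ℝ) : ℂ) • Ω = 0 := hcyc _ fun a => by
    have h1 : ⟪p, π a Ω⟫_ℂ = ⟪p, π a p⟫_ℂ := by
      simp [hpq, hcross]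
    have h2 := congrFun hext a
    rw [inner_sub_left, inner_smul_left, h1, ← h2, Complex.conj_ofReal]
    push_cast
    field_simp
    ring
  apply htop
  have : Ω = (((‖p‖ ^ 2 : ℝ) : ℂ)⁻¹) • p := by
    rw [eq_inv_smul_iff₀ (by exact_mod_cast pow_ne_zero 2 hp3)]
    exact (sub_eq_zero.1 hpΩ).symm
  rw [this]
  exact K.smul_mem _ hp

/-- The inner product of `H`, on the lift of `H` to a larger universe. -/
@[reducible]
noncomputable def uliftInnerProductSpace : InnerProductSpace ℂ (ULift.{w} H) where
  inner x y := ⟪x.down, y.down⟫_ℂ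
  norm_sq_eq_re_inner x := norm_sq_eq_re_inner (𝕜 := ℂ) x.down
  conj_inner_symm x y := inner_conj_symm x.down y.down
  add_left x y z := inner_add_left x.down y.down z.down
  smul_left x y r := inner_smul_left x.down y.down r

end PureStates

/-- The GNS representation of a state, in an arbitrarily large universe. -/
lemma exists_cyclic_representation {A : Type u} [CStarAlgebra A] [PartialOrder A]
    [StarOrderedRing A] {φ : A → ℂ} (hφ : φ ∈ stateSpace A) :
    ∃ (H : Type (max u w)) (_ : NormedAddCommGroup H) (_ : InnerProductSpace ℂ H)
      (_ : CompleteSpace H) (π : A →⋆ₐ[ℂ] (H →L[ℂ] H)) (Ω : H),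
      (∀ a, φ a = ⟪Ω, π a Ω⟫_ℂ) ∧ DenseRange fun a => π a Ω := by
  open scoped ComplexOrder in
  let f : A →ₚ[ℂ] ℂ := PositiveLinearMap.mk₀ (stateLinearMap hφ) fun a ha => state_nonneg hφ ha
  let _ : InnerProductSpace ℂ (ULift.{w} f.GNS) := uliftInnerProductSpace
  let e : f.GNS ≃ₗᵢ[ℂ] ULift.{w} f.GNS :=
    { ULift.moduleEquiv.symm with norm_map' := fun x => rfl }
  have : CompleteSpace (ULift.{w} f.GNS) :=
    (completeSpace_congr (e := e.toEquiv) e.isometry.isUniformEmbedding).1 inferInstance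
  have hΩ : ∀ a, f.gnsStarAlgHom a (f.toPreGNS 1 : f.PreGNS) = (f.toPreGNS a : f.PreGNS) := by
    intro a
    change f.gnsNonUnitalStarAlgHom a _ = _
    rw [f.gnsNonUnitalStarAlgHom_apply_coe]
    simp
  refine ⟨ULift.{w} f.GNS, inferInstance, inferInstance, inferInstance,
    e.conjStarAlgEquiv.toStarAlgHom.comp f.gnsStarAlgHom,
    e (f.toPreGNS 1 : f.PreGNS), fun a => ?_, ?_⟩
  · change φ a = ⟪e _, e (f.gnsStarAlgHom a (e.symm (e _)))⟫_ℂ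
    rw [e.symm_apply_apply, e.inner_map_map, hΩ, UniformSpace.Completion.inner_coe,
      PositiveLinearMap.preGNS_inner_def]
    simp
    rfl
  · have : (fun a => e (f.gnsStarAlgHom a (e.symm (e (f.toPreGNS 1 : f.PreGNS))))) =
        e ∘ (fun a : f.PreGNS => (a : f.GNS)) ∘ f.toPreGNS := by
      ext a
      simp only [e.symm_apply_apply, hΩ, Function.comp_apply]
    change DenseRange (fun a => e (f.gnsStarAlgHom a (e.symm (e (f.toPreGNS 1 : f.PreGNS)))))
    rw [this]
    exact e.surjective.denseRange.comp (UniformSpace.Completion.denseRange_coe.comp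
      f.toPreGNS.surjective.denseRange (UniformSpace.Completion.continuous_coe _)) e.continuous


/-! ### The module action, and contractions nearly annihilating given vectors. -/

section Contractions

variable {B : Type*} [NonUnitalCStarAlgebra B] [PartialOrder B]
  {X : Type*} [NormedAddCommGroup X] [NormedSpace ℂ X] [SMul Bᵐᵒᵖ X] [CStarModule Bᵐᵒᵖ X]

lemma binner_sub_left (x y z : X) : binner B (x - y) z = binner B x z - binner B y z := by
  simp [binner]

lemma binner_sub_right (x y z : X) : binner B x (y - z) = binner B x y - binner B x z := by
  simp [binner]

/-- Nondegeneracy of the inner product. The algebraic laws of the action of `B`, which is assumed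
only as an `SMul`, are derived from it. -/
lemma eq_of_forall_binner_eq {x y : X} (h : ∀ w, binner B w x = binner B w y) : x = y := by
  rw [← sub_eq_zero, ← CStarModule.inner_self (A := Bᵐᵒᵖ)]
  have : binner B (x - y) (x - y) = 0 := by rw [binner_sub_right, h, sub_self]
  exact MulOpposite.unop_injective this

lemma norm_sq_eq_norm_binner (x : X) : ‖x‖ ^ 2 = ‖binner B x x‖ := by
  rw [CStarModule.norm_sq_eq (A := Bᵐᵒᵖ)]
  rfl

lemma act_add (b : B) (x y : X) :
    MulOpposite.op b • (x + y) = MulOpposite.op b • x + MulOpposite.op b • y :=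
  eq_of_forall_binner_eq (B := B) fun w => by
    simp [binner_act_right, binner_add_right, add_mul]

lemma act_smul (b : B) (c : ℂ) (x : X) :
    MulOpposite.op b • (c • x) = c • (MulOpposite.op b • x) :=
  eq_of_forall_binner_eq (B := B) fun w => by
    simp [binner_act_right, binner_smul_right, smul_mul_assoc]

lemma add_act (a b : B) (x : X) :
    MulOpposite.op (a + b) • x = MulOpposite.op a • x + MulOpposite.op b • x :=
  eq_of_forall_binner_eq (B := B) fun w => by
    simp only [binner_act_right, binner_add_right, mul_add]

lemma smul_act (c : ℂ) (b : B) (x : X) :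
    MulOpposite.op (c • b) • x = c • (MulOpposite.op b • x) :=
  eq_of_forall_binner_eq (B := B) fun w => by
    simp only [binner_act_right, binner_smul_right, mul_smul_comm]

lemma norm_act_le (b : B) (x : X) : ‖MulOpposite.op b • x‖ ≤ ‖x‖ * ‖b‖ := by
  refine le_of_sq_le_sq ?_ (by positivity)
  rw [norm_sq_eq_norm_binner (B := B), binner_act_left, binner_act_right, mul_pow,
    norm_sq_eq_norm_binner (B := B)]
  calc ‖star b * (binner B x x * b)‖ ≤ ‖star b‖ * (‖binner B x x‖ * ‖b‖) :=
        (norm_mul_le _ _).trans (by gcongr; exact norm_mul_le _ _)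
    _ = ‖binner B x x‖ * ‖b‖ ^ 2 := by rw [norm_star]; ring

/-- The action of an element of `B` on `X`, as a continuous linear map. -/
noncomputable def actL (b : B) : X →L[ℂ] X :=
  LinearMap.mkContinuous
    { toFun := fun x => MulOpposite.op b • x
      map_add' := act_add b
      map_smul' := act_smul b } ‖b‖ fun x => by
    rw [mul_comm]
    exact norm_act_le b x

variable [StarOrderedRing B]

lemma norm_binner_le (x y : X) : ‖binner B x y‖ ≤ ‖x‖ * ‖y‖ :=
  CStarModule.norm_inner_le (A := Bᵐᵒᵖ) X

variable (B) in
lemma continuous_binner_right (x : X) : Continuous fun y : X => binner B x y :=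
  MulOpposite.continuous_unop.comp
    ((CStarModule.continuous_inner (A := Bᵐᵒᵖ) (E := X)).comp (by fun_prop : Continuous fun y : X => (x, y)))

/-- Regularised inverse of a positive element. -/
lemma exists_regularised_inverse {a : B} (ha : 0 ≤ a) {ε : ℝ} (hε : 0 < ε) :
    ∃ f : B, star f = f ∧ f * a * f ≤ f + f ∧ ‖a - a * f * a - (a * f * a - a * f * a * f * a)‖ ≤ ε := by
  have hsa : IsSelfAdjoint a := .of_nonneg ha
  -- Unlike `1 / (t + ε)`, this approximation of `1 / t` vanishes at `0`, as the non-unital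
  -- functional calculus requires. The two bounds come from `t * g t ≤ 1` and `t * (1 - t * g t)² ≤
  -- ε` for `t ≥ 0`.
  set g : ℝ → ℝ := fun t => t / (t ^ 2 + ε ^ 2) with hg
  have hpos : ∀ t : ℝ, 0 < t ^ 2 + ε ^ 2 := fun t => by positivity
  have hgc : Continuous g := by
    refine continuous_id.div (by fun_prop) fun t => (hpos t).ne'
  have hg0 : g 0 = 0 := by simp [hg]
  have hid : cfcₙ (id : ℝ → ℝ) a = a := cfcₙ_id ℝ a
  have hgco := hgc.continuousOn (s := quasispectrum ℝ a)
  have hido : ContinuousOn (id : ℝ → ℝ) (quasispectrum ℝ a) := continuousOn_id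
  have mul_id : ∀ h : ℝ → ℝ, Continuous h → h 0 = 0 →
      cfcₙ h a * a = cfcₙ (fun t => h t * t) a := by
    intro h hc h0
    conv_lhs => enter [2]; rw [← hid]
    exact (cfcₙ_mul h id a hc.continuousOn h0 hido rfl).symm
  have mul_g : ∀ h : ℝ → ℝ, Continuous h → h 0 = 0 →
      cfcₙ h a * cfcₙ g a = cfcₙ (fun t => h t * g t) a := fun h hc h0 =>
    (cfcₙ_mul h g a hc.continuousOn h0 hgco hg0).symm
  have sub_cfc : ∀ h k : ℝ → ℝ, Continuous h → h 0 = 0 → Continuous k → k 0 = 0 →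
      cfcₙ h a - cfcₙ k a = cfcₙ (fun t => h t - k t) a := fun h k hc h0 kc k0 =>
    (cfcₙ_sub h k a hc.continuousOn h0 kc.continuousOn k0).symm
  have hfaf : cfcₙ g a * a * cfcₙ g a = cfcₙ (fun t => g t * t * g t) a := by
    rw [mul_id g hgc hg0, mul_g _ (by fun_prop) (by simp)]
  have hafa : a * cfcₙ g a * a = cfcₙ (fun t => t * g t * t) a := by
    have : a * cfcₙ g a = cfcₙ (fun t => t * g t) a := by
      conv_lhs => enter [1]; rw [← hid]
      exact mul_g id continuous_id rfl
    rw [this, mul_id _ (by fun_prop) (by simp)]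
  have hafafa : a * cfcₙ g a * a * cfcₙ g a * a = cfcₙ (fun t => t * g t * t * g t * t) a := by
    rw [hafa, mul_g _ (by fun_prop) (by simp), mul_id _ (by fun_prop) (by simp)]
  have hspec : ∀ t ∈ quasispectrum ℝ a, 0 ≤ t := fun t ht => quasispectrum_nonneg_of_nonneg a ha t ht
  refine ⟨cfcₙ g a, (cfcₙ_predicate g a : IsSelfAdjoint _), ?_, ?_⟩
  · rw [hfaf, ← cfcₙ_add (f := g) (g := g) (a := a) hgco hg0 hgco hg0]
    refine cfcₙ_mono fun t ht => ?_
    have h0 := hspec t ht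
    have hgt : 0 ≤ g t := div_nonneg h0 (hpos t).le
    have h1 : t * g t ≤ 1 := by
      rw [hg]
      simp only
      rw [mul_div_assoc', div_le_one (hpos t)]
      nlinarith [sq_nonneg ε]
    nlinarith
  · rw [hafafa, hafa]
    conv_lhs => enter [1, 1, 1]; rw [← hid]
    rw [sub_cfc id _ continuous_id rfl (by fun_prop) (by simp),
      sub_cfc _ _ (by fun_prop) (by simp) (by fun_prop) (by simp),
      sub_cfc _ _ (by fun_prop) (by simp) (by fun_prop) (by simp)]
    refine norm_cfcₙ_le fun t ht => ?_
    have h0 := hspec t ht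
    have e : id t - t * g t * t - (t * g t * t - t * g t * t * g t * t) =
        t * (ε ^ 2 / (t ^ 2 + ε ^ 2)) ^ 2 := by
      have := (hpos t).ne'
      simp only [hg, id]
      field_simp
      ring
    rw [e, Real.norm_of_nonneg (by positivity), div_pow, mul_div_assoc', div_le_iff₀ (by have := hpos t; positivity)]
    have : t * ε ≤ t ^ 2 + ε ^ 2 := by nlinarith [sq_nonneg (t - ε), sq_nonneg (t + ε)]
    have h2 : ε ^ 2 ≤ t ^ 2 + ε ^ 2 := by nlinarith [sq_nonneg t]
    calc t * (ε ^ 2) ^ 2 = ε * ((t * ε) * ε ^ 2) := by ring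
      _ ≤ ε * ((t ^ 2 + ε ^ 2) * (t ^ 2 + ε ^ 2)) := by gcongr
      _ = ε * (t ^ 2 + ε ^ 2) ^ 2 := by ring

/-- A contraction of `X`, equal to the identity modulo a submodule `Z`. -/
structure IsContractionModulo (B : Type*) [NonUnitalCStarAlgebra B] [PartialOrder B]
    {X : Type*} [NormedAddCommGroup X] [NormedSpace ℂ X] [SMul Bᵐᵒᵖ X] [CStarModule Bᵐᵒᵖ X]
    (Z : Submodule ℂ X) (c : X →ₗ[ℂ] X) : Prop where
  sub_mem : ∀ w, w - c w ∈ Z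
  binner_le : ∀ w, binner B (c w) (c w) ≤ binner B w w

lemma IsContractionModulo.norm_le {Z : Submodule ℂ X} {c : X →ₗ[ℂ] X}
    (hc : IsContractionModulo B Z c) (w : X) : ‖c w‖ ≤ ‖w‖ := by
  refine le_of_sq_le_sq ?_ (norm_nonneg w)
  rw [norm_sq_eq_norm_binner (B := B), norm_sq_eq_norm_binner (B := B)]
  exact CStarAlgebra.norm_le_norm_of_nonneg_of_le (binner_self_nonneg _) (hc.binner_le w)

/-- The map is `w ↦ w - z · f⟨z, w⟩` with `f` a regularised inverse of `a = ⟨z, z⟩`, an approximate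
projection away from `z`. It lowers `⟨w, w⟩` by `⟨w, z⟩ (2f - faf) ⟨z, w⟩ ≥ 0`, and at `w = z` only
`a - a(2f - faf)a` remains. -/
lemma exists_contraction_norm_apply_le {Z : Submodule ℂ X}
    (hZ : ∀ (b : B), ∀ x ∈ Z, MulOpposite.op b • x ∈ Z) {z : X} (hz : z ∈ Z) {ε : ℝ}
    (hε : 0 < ε) : ∃ c : X →ₗ[ℂ] X, IsContractionModulo B Z c ∧ ‖c z‖ ≤ ε := by
  obtain ⟨f, hfs, hf, hfa⟩ := exists_regularised_inverse (binner_self_nonneg (B := B) z)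
    (pow_pos hε 2)
  let c : X →ₗ[ℂ] X :=
    { toFun := fun w => w - MulOpposite.op (f * binner B z w) • z
      map_add' := fun v w => by
        rw [binner_add_right, mul_add, add_act]
        abel
      map_smul' := fun r w => by
        rw [binner_smul_right, mul_smul_comm, smul_act, RingHom.id_apply, smul_sub] }
  have hcw : ∀ w, binner B (c w) (c w) = binner B w w - (star (binner B z w) * (f + f) * binner B z w
      - star (binner B z w) * (f * binner B z z * f) * binner B z w) := by
    intro w
    change binner B (w - _) (w - _) = _
    simp only [binner_sub_left, binner_sub_right, binner_act_left, binner_act_right, star_mul, hfs,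
      star_binner, mul_add, add_mul, sub_mul, mul_assoc]
    abel
  refine ⟨c, ⟨fun w => ?_, fun w => ?_⟩, ?_⟩
  · change w - (w - _) ∈ Z
    rw [sub_sub_cancel]
    exact hZ _ _ hz
  · rw [hcw]
    exact sub_le_self _ (sub_nonneg.2 (star_left_conjugate_le_conjugate hf _))
  · refine le_of_sq_le_sq ?_ hε.le
    rw [norm_sq_eq_norm_binner (B := B), hcw]
    refine le_trans (le_of_eq (congrArg _ ?_)) hfa
    simp only [star_binner, mul_add, add_mul, mul_assoc]
    abel

/-- Contractions are composed one vector at a time. The image of the next vector is still in `Z`,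
and later contractions do not spoil the earlier bounds. -/
lemma exists_contraction_forall_norm_apply_le {Z : Submodule ℂ X}
    (hZ : ∀ (b : B), ∀ x ∈ Z, MulOpposite.op b • x ∈ Z) {ε : ℝ} (hε : 0 < ε) (s : Finset X)
    (hs : ∀ z ∈ s, z ∈ Z) :
    ∃ c : X →ₗ[ℂ] X, IsContractionModulo B Z c ∧ ∀ z ∈ s, ‖c z‖ ≤ ε := by
  classical
  induction s using Finset.induction_on with
  | empty => exact ⟨LinearMap.id, ⟨by simp, by simp⟩, by simp⟩
  | insert z s _ ih =>
    obtain ⟨c, hc, hcs⟩ := ih fun z hz => hs z (Finset.mem_insert_of_mem hz)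
    have hcz : c z ∈ Z := by
      simpa using Z.sub_mem (hs z (Finset.mem_insert_self _ _)) (hc.sub_mem z)
    obtain ⟨d, hd, hdz⟩ := exists_contraction_norm_apply_le hZ hcz hε
    refine ⟨d ∘ₗ c, ⟨fun w => ?_, fun w => (hd.binner_le _).trans (hc.binner_le w)⟩, ?_⟩
    · simpa using Z.add_mem (hc.sub_mem w) (hd.sub_mem (c w))
    · intro y hy
      rcases Finset.mem_insert.1 hy with rfl | hy
      · exact hdz
      · exact (hd.norm_le _).trans (hcs y hy)

end Contractions


/-! ### States separating a vector from a submodule. -/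

section StateSeparation

variable {B : Type*} [NonUnitalCStarAlgebra B] [PartialOrder B]
  {X : Type*} [NormedAddCommGroup X] [NormedSpace ℂ X] [SMul Bᵐᵒᵖ X] [CStarModule Bᵐᵒᵖ X]

/-- The value of a functional of the unitization of `B` at `⟨x, x⟩`. -/
noncomputable def stateSq (φ : Unitization ℂ B → ℂ) (x : X) : ℝ :=
  (φ (binner B x x : Unitization ℂ B)).re

lemma stateSq_le_norm_sq {φ : Unitization ℂ B → ℂ} (hφ : φ ∈ stateSpace (Unitization ℂ B)) (x : X) :
    stateSq φ x ≤ ‖x‖ ^ 2 := by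
  rw [norm_sq_eq_norm_binner (B := B), ← Unitization.norm_inr (𝕜 := ℂ)]
  exact (Complex.re_le_norm _).trans (hφ.2.2.1 _)

variable (B) in
/-- The states whose squared distance from `x` to `Z` is as large as possible. -/
def separatingStates (Z : Submodule ℂ X) (x : X) : Set (Unitization ℂ B → ℂ) :=
  stateSpace (Unitization ℂ B) ∩
    ⋂ z : Z, {φ | Metric.infDist x (Z : Set X) ^ 2 ≤ stateSq φ (x - z)}

lemma mem_separatingStates {Z : Submodule ℂ X} {x : X} {φ : Unitization ℂ B → ℂ} :
    φ ∈ separatingStates B Z x ↔ φ ∈ stateSpace (Unitization ℂ B) ∧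
      ∀ z ∈ Z, Metric.infDist x (Z : Set X) ^ 2 ≤ stateSq φ (x - z) := by
  simp [separatingStates]

lemma continuous_stateSq (x : X) : Continuous fun φ : Unitization ℂ B → ℂ => stateSq φ x :=
  Complex.continuous_re.comp (continuous_apply _)

lemma isCompact_separatingStates (Z : Submodule ℂ X) (x : X) :
    IsCompact (separatingStates B Z x) :=
  (isCompact_stateSpace _).inter_right <| isClosed_iInter fun _ =>
    isClosed_le continuous_const (continuous_stateSq _)

lemma infDist_sq_le_norm_sq {Z : Submodule ℂ X} (x : X) {z : X} (hz : z ∈ Z) :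
    Metric.infDist x (Z : Set X) ^ 2 ≤ ‖x - z‖ ^ 2 := by
  gcongr
  · exact Metric.infDist_nonneg
  · rw [← dist_eq_norm]
    exact Metric.infDist_le_dist_of_mem hz

variable [StarOrderedRing B]

/-- Take `z' = x - c x` with `c` a contraction modulo `Z` that nearly kills `s`. Then `x - z' = c (x
- z) + c z` for each `z ∈ s`: the first term is dominated by `x - z` in every state, and the second
is small in norm. -/
lemma exists_forall_stateSq_sub_le {Z : Submodule ℂ X}
    (hZ : ∀ (b : B), ∀ x ∈ Z, MulOpposite.op b • x ∈ Z) (x : X) (s : Finset X)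
    (hs : ∀ z ∈ s, z ∈ Z) {δ : ℝ} (hδ : 0 < δ) :
    ∃ z' ∈ Z, ∀ z ∈ s, ∀ φ ∈ stateSpace (Unitization ℂ B),
      stateSq φ (x - z') ≤ stateSq φ (x - z) + δ := by
  set R : ℝ := ∑ z ∈ s, ‖x - z‖
  have hR : 0 ≤ R := Finset.sum_nonneg fun _ _ => norm_nonneg _
  set ε : ℝ := min 1 (δ / (2 * R + 1))
  have hε : 0 < ε := lt_min one_pos (by positivity)
  have hεδ : 2 * R * ε + ε ^ 2 ≤ δ := by
    have h1 : ε ≤ 1 := min_le_left _ _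
    have h2 : ε * (2 * R + 1) ≤ δ := (le_div_iff₀ (by positivity)).1 (min_le_right _ _)
    nlinarith
  obtain ⟨c, hc, hcs⟩ := exists_contraction_forall_norm_apply_le hZ hε s hs
  refine ⟨x - c x, hc.sub_mem x, fun z hz φ hφ => ?_⟩
  have hcx : x - (x - c x) = c (x - z) + c z := by simp
  have hu : ‖c (x - z)‖ ≤ R := (hc.norm_le _).trans
    (Finset.single_le_sum (f := fun z => ‖x - z‖) (fun _ _ => norm_nonneg _) hz)
  have hv := hcs z hz
  have hmono : stateSq φ (c (x - z)) ≤ stateSq φ (x - z) := by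
    have h1 : 0 ≤ binner B (x - z) (x - z) - binner B (c (x - z)) (c (x - z)) :=
      sub_nonneg.2 (hc.binner_le _)
    have h2 := state_nonneg hφ (Unitization.inr_nonneg_iff.2 h1)
    have h3 := map_sub (stateLinearMap hφ) (binner B (x - z) (x - z) : Unitization ℂ B)
      (binner B (c (x - z)) (c (x - z)))
    rw [← Unitization.inr_sub] at h3
    change φ _ = φ _ - φ _ at h3
    rw [h3] at h2
    have h4 := (Complex.le_def.1 h2).1
    simp only [Complex.zero_re, Complex.sub_re] at h4
    exact sub_nonneg.1 h4
  set u := c (x - z)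
  set v := c z
  set r : B := binner B u v + binner B v u + binner B v v
  have hr : ‖r‖ ≤ δ := by
    refine le_trans ?_ hεδ
    calc ‖r‖ ≤ ‖u‖ * ‖v‖ + ‖v‖ * ‖u‖ + ‖v‖ * ‖v‖ := (norm_add₃_le).trans (by
          gcongr <;> exact norm_binner_le _ _)
      _ ≤ R * ε + ε * R + ε * ε := by gcongr
      _ = _ := by ring
  have hexp : binner B (u + v) (u + v) = binner B u u + r := by
    simp only [binner_add_left, binner_add_right, r]
    abel
  have hφr : (φ (r : Unitization ℂ B)).re ≤ δ :=
    (Complex.re_le_norm _).trans ((hφ.2.2.1 _).trans (by rwa [Unitization.norm_inr]))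
  rw [hcx, stateSq, hexp, Unitization.inr_add, hφ.1, Complex.add_re]
  exact add_le_add hmono hφr

/-- For finitely many conditions, a common approximant `z'` and a state attaining the norm of `⟨x -
z', x - z'⟩` suffice, up to a small error. Compactness handles all conditions together. -/
lemma separatingStates_nonempty {Z : Submodule ℂ X}
    (hZ : ∀ (b : B), ∀ x ∈ Z, MulOpposite.op b • x ∈ Z) (x : X) :
    (separatingStates B Z x).Nonempty := by
  classical
  -- The slack `1 / (n + 1)` absorbs that error; the largest `n` in a finite subfamily dictates how
  -- small the error has to be.
  have key : (stateSpace (Unitization ℂ B) ∩ ⋂ i : Z × ℕ,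
      {φ | Metric.infDist x (Z : Set X) ^ 2 - 1 / ((i.2 : ℝ) + 1) ≤
        stateSq φ (x - i.1)}).Nonempty := by
    refine (isCompact_stateSpace _).inter_iInter_nonempty _
      (fun i => isClosed_le continuous_const (continuous_stateSq _)) fun t => ?_
    obtain ⟨z', hz', h⟩ := exists_forall_stateSq_sub_le hZ x (t.image fun i => (i.1 : X))
      (by simp only [Finset.mem_image]; rintro _ ⟨i, -, rfl⟩; exact i.1.2)
      (δ := 1 / ((t.sup Prod.snd : ℕ) + 1 : ℝ)) (by positivity)
    obtain ⟨φ, hφ, hφz⟩ := exists_state_apply_eq_norm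
      (Unitization.inr_nonneg_iff.2 (binner_self_nonneg (B := B) (x - z')))
    refine ⟨φ, hφ, Set.mem_iInter₂.2 fun i hi => ?_⟩
    have h1 := h i.1 (Finset.mem_image_of_mem _ hi) φ hφ
    have h2 : stateSq φ (x - z') = ‖x - z'‖ ^ 2 := by
      rw [stateSq, hφz, norm_sq_eq_norm_binner (B := B), Unitization.norm_inr, Complex.ofReal_re]
    have h3 := infDist_sq_le_norm_sq x hz'
    have h4 : 1 / ((t.sup Prod.snd : ℕ) + 1 : ℝ) ≤ 1 / ((i.2 : ℝ) + 1) := by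
      gcongr
      exact Finset.le_sup (f := Prod.snd) hi
    rw [Set.mem_ofPred_eq]
    linarith
  obtain ⟨φ, hφ, hφi⟩ := key
  refine ⟨φ, mem_separatingStates.2 ⟨hφ, fun z hz => le_of_forall_pos_le_add fun ε hε => ?_⟩⟩
  obtain ⟨n, hn⟩ := exists_nat_one_div_lt hε
  have := Set.mem_iInter.1 hφi (⟨z, hz⟩, n)
  rw [Set.mem_ofPred_eq] at this
  linarith

lemma isExtreme_separatingStates {Z : Submodule ℂ X}
    (hZ : ∀ (b : B), ∀ x ∈ Z, MulOpposite.op b • x ∈ Z) (x : X) :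
    IsExtreme ℝ (stateSpace (Unitization ℂ B)) (separatingStates B Z x) := by
  classical
  refine ⟨Set.inter_subset_left, ?_⟩
  rintro φ hφ ψ hψ θ hθ ⟨a, b, ha, hb, hab, rfl⟩
  refine mem_separatingStates.2 ⟨hφ, fun z hz => ?_⟩
  by_contra! hlt
  set d := Metric.infDist x (Z : Set X)
  have hd : 0 ≤ d := Metric.infDist_nonneg
  -- If `φ` violates the condition at `z`, choose `y` nearly optimal in norm, hence good for `ψ`,
  -- and `z'` a common approximant for `z` and `y`. With this `δ` the value of the mixture at `x -
  -- z'` is at most `d² - 2δ`, contradicting membership of the mixture.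
  set δ := a * (d ^ 2 - stateSq φ (x - z)) / 4 with hδd
  have hδ : 0 < δ := div_pos (mul_pos ha (sub_pos.2 hlt)) four_pos
  obtain ⟨y, hy, hxy⟩ : ∃ y ∈ Z, dist x y < √(d ^ 2 + δ) :=
    (Metric.infDist_lt_iff ⟨0, Z.zero_mem⟩).1 (Real.lt_sqrt_of_sq_lt (by linarith))
  have hy2 : stateSq ψ (x - y) ≤ d ^ 2 + δ := by
    refine (stateSq_le_norm_sq hψ _).trans ?_
    rw [← dist_eq_norm]
    exact (Real.lt_sqrt dist_nonneg).1 hxy |>.le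
  obtain ⟨z', hz', h⟩ := exists_forall_stateSq_sub_le hZ x {z, y} (by simp [hz, hy]) hδ
  have h1 := h z (by simp) φ hφ
  have h2 := h y (by simp) ψ hψ
  have h3 := (mem_separatingStates.1 hθ).2 z' hz'
  have h4 : stateSq (a • φ + b • ψ) (x - z') = a * stateSq φ (x - z') + b * stateSq ψ (x - z') := by
    simp [stateSq]
  rw [h4] at h3
  have e1 := mul_le_mul_of_nonneg_left h1 ha.le
  have e2 := mul_le_mul_of_nonneg_left (h2.trans (add_le_add_left hy2 δ)) hb.le
  have e3 : b = 1 - a := by linarith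
  subst e3
  have : (1 - a) * δ ≤ δ := by nlinarith
  nlinarith

end StateSeparation

/-! ### Localised submodules and their orthogonal complements. -/

section Tmul

variable {B : Type*} [NonUnitalCStarAlgebra B] [PartialOrder B] [StarOrderedRing B]
  {X : Type*} [NormedAddCommGroup X] [NormedSpace ℂ X] [SMul Bᵐᵒᵖ X] [CStarModule Bᵐᵒᵖ X]
  {H : Type*} [NormedAddCommGroup H] [InnerProductSpace ℂ H] [CompleteSpace H]
  (π : B →⋆ₙₐ[ℂ] (H →L[ℂ] H))

lemma norm_tmul_le (x : X) (h : H) : ‖tmul π x h‖ ≤ 1 * ‖x‖ * ‖h‖ := by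
  refine le_of_sq_le_sq ?_ (by positivity)
  rw [← inner_self_eq_norm_sq (𝕜 := ℂ), inner_tmul]
  calc _ ≤ ‖⟪h, π (binner B x x) h⟫_ℂ‖ := Complex.re_le_norm _
    _ ≤ ‖h‖ * (‖binner B x x‖ * ‖h‖) := (norm_inner_le_norm _ _).trans (by
        gcongr
        exact ((π _).le_opNorm h).trans (by
          gcongr
          exact NonUnitalStarAlgHom.norm_apply_le π _))
    _ = (1 * ‖x‖ * ‖h‖) ^ 2 := by rw [← norm_sq_eq_norm_binner]; ring

variable (X) in
/-- The map `(x, h) ↦ x ⊗ h` as a continuous bilinear map. -/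
noncomputable def tmulL : X →L[ℂ] H →L[ℂ] Loc X π :=
  LinearMap.mkContinuous₂
    ((TensorProduct.mk ℂ X H).compr₂
      (UniformSpace.Completion.toComplL (𝕜 := ℂ) (E := PreLoc X π)).toLinearMap) 1
    (norm_tmul_le π)

@[simp]
lemma tmulL_apply (x : X) (h : H) : tmulL X π x h = tmul π x h := rfl

lemma tmul_mem_locSubmodule {M : Submodule ℂ X} {m : X} (hm : m ∈ M) (h : H) :
    tmul π m h ∈ locSubmodule π M :=
  Submodule.le_topologicalClosure _ (Submodule.subset_span ⟨m, hm, h, rfl⟩)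

lemma isClosed_locSubmodule (M : Submodule ℂ X) : IsClosed (locSubmodule π M : Set (Loc X π)) :=
  Submodule.isClosed_topologicalClosure _

lemma locSubmodule_le {M : Submodule ℂ X} {V : Submodule ℂ (Loc X π)}
    (hV : IsClosed (V : Set (Loc X π))) (h : ∀ m ∈ M, ∀ h : H, tmul π m h ∈ V) :
    locSubmodule π M ≤ V :=
  Submodule.topologicalClosure_minimal _
    (Submodule.span_le.2 (by rintro _ ⟨m, hm, k, rfl⟩; exact h m hm k)) hV

lemma locSubmodule_mono {M N : Submodule ℂ X} (h : M ≤ N) : locSubmodule π M ≤ locSubmodule π N :=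
  locSubmodule_le π (isClosed_locSubmodule π N) fun _ hm k => tmul_mem_locSubmodule π (h hm) k

lemma mem_orthogonal_locSubmodule {M : Submodule ℂ X} {b : Loc X π} :
    b ∈ (locSubmodule π M)ᗮ ↔ ∀ m ∈ M, ∀ h : H, ⟪tmul π m h, b⟫_ℂ = 0 := by
  refine ⟨fun hb m hm h => hb _ (tmul_mem_locSubmodule π hm h), fun hb => ?_⟩
  have hle : locSubmodule π M ≤ (ℂ ∙ b)ᗮ := locSubmodule_le π
    (Submodule.isClosed_orthogonal _) fun m hm h => by
      rw [Submodule.mem_orthogonal_singleton_iff_inner_left]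
      exact hb m hm h
  exact fun u hu => Submodule.mem_orthogonal_singleton_iff_inner_left.1 (hle hu)

lemma eq_zero_of_forall_inner_tmul_eq_zero {b : Loc X π}
    (hb : ∀ (x : X) (h : H), ⟪tmul π x h, b⟫_ℂ = 0) : b = 0 := by
  have key : ∀ t : X ⊗[ℂ] H, ⟪((show PreLoc X π from t : PreLoc X π) : Loc X π), b⟫_ℂ = 0 := by
    intro t
    induction t using TensorProduct.induction_on with
    | zero =>
      change ⟪((0 : PreLoc X π) : Loc X π), b⟫_ℂ = 0
      rw [UniformSpace.Completion.coe_zero, inner_zero_left]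
    | tmul x h => exact hb x h
    | add s t hs ht =>
      have : ⟪((show PreLoc X π from s : PreLoc X π) : Loc X π) +
          ((show PreLoc X π from t : PreLoc X π) : Loc X π), b⟫_ℂ = 0 := by
        rw [inner_add_left, hs, ht, add_zero]
      rwa [← UniformSpace.Completion.coe_add] at this
  have : ∀ c : Loc X π, ⟪c, b⟫_ℂ = 0 := fun c =>
    UniformSpace.Completion.induction_on c (isClosed_eq (by fun_prop) (by fun_prop)) key
  exact inner_self_eq_zero.1 (this b)

/-- The vectors `x` with `x ⊗ h ⟂ b` for all `h`. -/
def tmulOrthogonal (b : Loc X π) : Submodule ℂ X where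
  carrier := {x | ∀ h : H, ⟪tmul π x h, b⟫_ℂ = 0}
  add_mem' {x y} hx hy h := by
    rw [← tmulL_apply, map_add, _root_.add_apply, inner_add_left, tmulL_apply,
      tmulL_apply, hx h, hy h, add_zero]
  zero_mem' h := by
    rw [← tmulL_apply, map_zero, _root_.zero_apply, inner_zero_left]
  smul_mem' c x hx h := by
    rw [← tmulL_apply, map_smul, _root_.smul_apply, inner_smul_left, tmulL_apply, hx h,
      mul_zero]

lemma mem_tmulOrthogonal {b : Loc X π} {x : X} :
    x ∈ tmulOrthogonal π b ↔ ∀ h : H, ⟪tmul π x h, b⟫_ℂ = 0 := Iff.rfl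

/-- This moves orthogonality in `X_π` back to inclusions of submodules of `X`, where suprema and
closures are easy to handle. -/
lemma le_tmulOrthogonal_iff {M : Submodule ℂ X} {b : Loc X π} :
    M ≤ tmulOrthogonal π b ↔ b ∈ (locSubmodule π M)ᗮ :=
  (mem_orthogonal_locSubmodule π).symm

lemma isClosed_tmulOrthogonal (b : Loc X π) : IsClosed (tmulOrthogonal π b : Set X) := by
  have : (tmulOrthogonal π b : Set X) = ⋂ h : H, {x | ⟪tmulL X π x h, b⟫_ℂ = 0} := by
    ext x
    simp [mem_tmulOrthogonal]
  rw [this]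
  exact isClosed_iInter fun h => isClosed_eq (by fun_prop) continuous_const

lemma eq_zero_of_tmulOrthogonal_eq_top {b : Loc X π} (h : tmulOrthogonal π b = ⊤) : b = 0 :=
  eq_zero_of_forall_inner_tmul_eq_zero π fun x => (h ▸ Submodule.mem_top : x ∈ tmulOrthogonal π b)

lemma locSubmodule_orthogonal_le (M : Submodule ℂ X) :
    locSubmodule π M ≤ (locSubmodule π (orthogonal B M))ᗮ := by
  refine locSubmodule_le π (Submodule.isClosed_orthogonal _) fun m hm k => ?_
  rw [mem_orthogonal_locSubmodule]
  intro n hn h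
  rw [inner_tmul, ← star_binner, hn m hm, star_zero, map_zero, _root_.zero_apply, inner_zero_right]

/-- A vector orthogonal to both `M_π` and `(Mᗮ)_π` is orthogonal to every `x ⊗ h`, since `M` and
`Mᗮ` span `X`; so it is zero. -/
lemma locSubmodule_eq_orthogonal {M : Submodule ℂ X} (hM : M ⊔ orthogonal B M = ⊤) :
    locSubmodule π M = (locSubmodule π (orthogonal B M))ᗮ := by
  refine le_antisymm (locSubmodule_orthogonal_le π M) fun b hb => ?_
  have : CompleteSpace (locSubmodule π M) := (isClosed_locSubmodule π M).completeSpace_coe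
  obtain ⟨a, ha, c, hc, rfl⟩ := (locSubmodule π M).exists_add_mem_mem_orthogonal b
  have hc' : c ∈ (locSubmodule π (orthogonal B M))ᗮ := by
    simpa using Submodule.sub_mem _ hb (locSubmodule_orthogonal_le π M ha)
  have : c = 0 := eq_zero_of_tmulOrthogonal_eq_top π (top_le_iff.1 (hM ▸ sup_le
    ((le_tmulOrthogonal_iff π).2 hc) ((le_tmulOrthogonal_iff π).2 hc')))
  rwa [this, add_zero]

end Tmul

/-! ### Detection of proper closed submodules by irreducible representations. -/

section Localise

/-- Every proper closed submodule of a Hilbert module is detected by an irreducible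
representation. -/
theorem exists_irreducible_locSubmodule_ne_top {B : Type u} [NonUnitalCStarAlgebra B]
    [PartialOrder B] [StarOrderedRing B] {X : Type v} [NormedAddCommGroup X] [NormedSpace ℂ X]
    [SMul Bᵐᵒᵖ X] [CStarModule Bᵐᵒᵖ X] {Z : Submodule ℂ X}
    (hZ : ∀ (b : B), ∀ x ∈ Z, MulOpposite.op b • x ∈ Z) (hZc : IsClosed (Z : Set X))
    (hne : Z ≠ ⊤) :
    ∃ (H : Type (max u w)) (_ : NormedAddCommGroup H) (_ : InnerProductSpace ℂ H)
      (_ : CompleteSpace H) (π : B →⋆ₙₐ[ℂ] (H →L[ℂ] H)), IsIrreducible π ∧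
      locSubmodule π Z ≠ ⊤ := by
  obtain ⟨x, hx⟩ : ∃ x, x ∉ Z := by
    by_contra! h
    exact hne (Submodule.eq_top_iff'.2 h)
  have hd : 0 < Metric.infDist x (Z : Set X) :=
    (hZc.notMem_iff_infDist_pos ⟨0, Z.zero_mem⟩).1 hx
  set d := Metric.infDist x (Z : Set X)
  obtain ⟨φ, hφ⟩ := (isCompact_separatingStates (B := B) Z x).extremePoints_nonempty
    (separatingStates_nonempty hZ x)
  have hφd := (mem_separatingStates.1 hφ.1).2
  have hφe := (isExtreme_separatingStates hZ x).extremePoints_subset_extremePoints hφ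
  obtain ⟨H, _, _, _, π, Ω, hπ, hΩ⟩ := exists_cyclic_representation.{u, w} hφe.1
  obtain rfl : φ = fun a => ⟪Ω, π a Ω⟫_ℂ := funext hπ
  let ρ : B →⋆ₙₐ[ℂ] (H →L[ℂ] H) := π.toNonUnitalStarAlgHom.comp
    (Unitization.inrNonUnitalStarAlgHom ℂ B)
  have hρ : ∀ b, ρ b = π (b : Unitization ℂ B) := fun b => rfl
  have hπρ : ∀ (a : Unitization ℂ B) (h : H), π a h = a.fst • h + ρ a.snd h := by
    intro a h
    conv_lhs => rw [← Unitization.inl_fst_add_inr_snd_eq a]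
    rw [map_add, _root_.add_apply, hρ]
    congr 1
    have : (Unitization.inl a.fst : Unitization ℂ B) = a.fst • 1 := by
      ext <;> simp
    rw [this, map_smul, map_one]
    rfl
  have hsq : ∀ y : X, ‖tmul ρ y Ω‖ ^ 2 = stateSq (fun a => ⟪Ω, π a Ω⟫_ℂ) y := by
    intro y
    rw [← inner_self_eq_norm_sq (𝕜 := ℂ), inner_tmul]
    rfl
  refine ⟨H, inferInstance, inferInstance, inferInstance, ρ, ⟨?_, ?_⟩, fun htop => ?_⟩
  -- A pure state of the unitization may be the character that kills `B`; this is excluded by `φ ⟨x,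
  -- x⟩ ≥ d² > 0`.
  · intro h0
    have h1 := hφd 0 Z.zero_mem
    rw [← hsq, ← inner_self_eq_norm_sq (𝕜 := ℂ), inner_tmul, h0] at h1
    have h2 : d ^ 2 ≤ 0 := by simpa using h1
    exact absurd h2 (not_le.2 (pow_pos hd 2))
  · intro K hK hinv
    refine eq_bot_or_eq_top_of_mem_extremePoints π hΩ hφe K hK fun a h hh => ?_
    rw [hπρ]
    exact K.add_mem (K.smul_mem _ hh) (hinv _ _ hh)
  · set V : Submodule ℂ (Loc X ρ) := Z.map ((tmulL X ρ).flip Ω).toLinearMap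
    -- By cyclicity it is enough to treat `z ⊗ π(a)Ω`, and balancing moves `a` to the left factor,
    -- giving `(z · a) ⊗ Ω` with `z · a ∈ Z`.
    have hV : locSubmodule ρ Z ≤ V.topologicalClosure := by
      refine locSubmodule_le ρ V.isClosed_topologicalClosure fun z hz h => ?_
      refine hΩ.induction_on (p := fun h => tmul ρ z h ∈ V.topologicalClosure) h
        (V.isClosed_topologicalClosure.preimage (tmulL X ρ z).continuous) fun a => ?_
      refine V.le_topologicalClosure ⟨a.fst • z + MulOpposite.op a.snd • z,
        Z.add_mem (Z.smul_mem _ hz) (hZ _ _ hz), ?_⟩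
      change tmulL X ρ (_ + _) Ω = tmulL X ρ z (π a Ω)
      rw [hπρ, map_add, map_add, _root_.add_apply, map_smul (tmulL X ρ z), map_smul (tmulL X ρ),
        _root_.smul_apply, tmulL_apply, tmulL_apply, tmulL_apply, tmul_balanced]
    have hxV : tmul ρ x Ω ∈ closure (V : Set (Loc X ρ)) := hV (htop ▸ Submodule.mem_top)
    obtain ⟨_, ⟨z, hz, rfl⟩, hlt⟩ := Metric.mem_closure_iff.1 hxV d hd
    have h1 : dist (tmul ρ x Ω) (((tmulL X ρ).flip Ω).toLinearMap z) = ‖tmul ρ (x - z) Ω‖ := by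
      rw [dist_eq_norm]
      congr 1
      change tmulL X ρ x Ω - tmulL X ρ z Ω = tmulL X ρ (x - z) Ω
      rw [map_sub, _root_.sub_apply]
    rw [h1] at hlt
    have h2 := hφd z hz
    rw [← hsq] at h2
    exact absurd (lt_of_le_of_lt h2 (by gcongr)) (lt_irrefl _)

end Localise

/-! ### Orthogonal complements and closed orthogonal sums in `X`. -/

section Concordance

variable {B : Type*} [NonUnitalCStarAlgebra B] [PartialOrder B]
  {X : Type*} [NormedAddCommGroup X] [NormedSpace ℂ X] [SMul Bᵐᵒᵖ X] [CStarModule Bᵐᵒᵖ X]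

lemma act_mem_orthogonal (M : Submodule ℂ X) (b : B) {x : X} (hx : x ∈ orthogonal B M) :
    MulOpposite.op b • x ∈ orthogonal B M := fun m hm => by
  rw [binner_act_right, hx m hm, zero_mul]

lemma orthogonal_orthogonal_le {M : Submodule ℂ X} (hM : M ⊔ orthogonal B M = ⊤) :
    orthogonal B (orthogonal B M) ≤ M := by
  intro x hx
  obtain ⟨m, hm, n, hn, rfl⟩ := Submodule.mem_sup.1 (hM ▸ Submodule.mem_top : x ∈ M ⊔ orthogonal B M)
  have h1 := hx n hn
  rw [binner_add_right, ← star_binner, hn m hm, star_zero, zero_add] at h1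
  have : n = 0 := (CStarModule.inner_self (A := Bᵐᵒᵖ)).1 (MulOpposite.unop_injective h1)
  rwa [this, add_zero]

lemma le_orthogonal_orthogonal (M : Submodule ℂ X) : M ≤ orthogonal B (orthogonal B M) :=
  fun m hm n hn => by rw [← star_binner, hn m hm, star_zero]

lemma orthogonal_anti {M N : Submodule ℂ X} (h : M ≤ N) : orthogonal B N ≤ orthogonal B M :=
  fun _ hx m hm => hx m (h hm)

lemma act_mem_topologicalClosure {W : Submodule ℂ X}
    (hW : ∀ (b : B), ∀ x ∈ W, MulOpposite.op b • x ∈ W) (b : B) {x : X}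
    (hx : x ∈ W.topologicalClosure) : MulOpposite.op b • x ∈ W.topologicalClosure :=
  map_mem_closure (actL b : X →L[ℂ] X).continuous hx fun y hy => hW b y hy

lemma act_mem_sup {P W : Submodule ℂ X} (hP : ∀ (b : B), ∀ x ∈ P, MulOpposite.op b • x ∈ P)
    (hW : ∀ (b : B), ∀ x ∈ W, MulOpposite.op b • x ∈ W) (b : B) {x : X} (hx : x ∈ P ⊔ W) :
    MulOpposite.op b • x ∈ P ⊔ W := by
  obtain ⟨p, hp, w, hw, rfl⟩ := Submodule.mem_sup.1 hx
  rw [act_add]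
  exact Submodule.add_mem_sup (hP b p hp) (hW b w hw)

variable [StarOrderedRing B]

variable (B) in
lemma isClosed_orthogonal (M : Submodule ℂ X) : IsClosed (orthogonal B M : Set X) := by
  have : (orthogonal B M : Set X) = ⋂ m : M, {x | binner B (m : X) x = 0} := by
    ext x
    simp [orthogonal]
  rw [this]
  exact isClosed_iInter fun m => isClosed_eq (continuous_binner_right B _) continuous_const

lemma isClosed_of_sup_orthogonal_eq_top {M : Submodule ℂ X} (hM : M ⊔ orthogonal B M = ⊤) :
    IsClosed (M : Set X) := by
  rw [le_antisymm (le_orthogonal_orthogonal M) (orthogonal_orthogonal_le hM)]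
  exact isClosed_orthogonal B _

lemma norm_le_norm_add_of_binner_eq_zero {x y : X} (h : binner B x y = 0) : ‖x‖ ≤ ‖x + y‖ := by
  refine le_of_sq_le_sq ?_ (norm_nonneg _)
  rw [norm_sq_eq_norm_binner (B := B), norm_sq_eq_norm_binner (B := B)]
  refine CStarAlgebra.norm_le_norm_of_nonneg_of_le (binner_self_nonneg _) ?_
  have h' : binner B y x = 0 := by rw [← star_binner, h, star_zero]
  rw [binner_add_left, binner_add_right, binner_add_right, h, h', add_zero, zero_add]
  exact le_add_of_nonneg_right (binner_self_nonneg _)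

/-- By orthogonality `‖p‖` and `‖w‖` are at most `‖p + w‖`, so the addition map `P × W → X` is
bounded below and has closed range. -/
lemma isClosed_sup_of_orthogonal [CompleteSpace X] {P W : Submodule ℂ X}
    (hP : IsClosed (P : Set X)) (hW : IsClosed (W : Set X)) (hPW : W ≤ orthogonal B P) :
    IsClosed ((P ⊔ W : Submodule ℂ X) : Set X) := by
  have : CompleteSpace P := hP.completeSpace_coe
  have : CompleteSpace W := hW.completeSpace_coe
  let f : P × W →L[ℂ] X := P.subtypeL.coprod W.subtypeL
  have hf : AntilipschitzWith 1 f := ContinuousLinearMap.antilipschitz_of_bound f fun p => by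
    have h0 : binner B (p.1 : X) (p.2 : X) = 0 := hPW p.2.2 _ p.1.2
    have h0' : binner B (p.2 : X) (p.1 : X) = 0 := by rw [← star_binner, h0, star_zero]
    rw [NNReal.coe_one, one_mul]
    refine max_le (norm_le_norm_add_of_binner_eq_zero h0) ?_
    change _ ≤ ‖(p.1 : X) + p.2‖
    rw [add_comm]
    exact norm_le_norm_add_of_binner_eq_zero h0'
  have hr : ((P ⊔ W : Submodule ℂ X) : Set X) = Set.range f := by
    ext x
    simp [f, Submodule.mem_sup]
  rw [hr]
  exact hf.isClosed_range f.uniformContinuous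

lemma topologicalClosure_sup_le_orthogonal (M N : Submodule ℂ X) :
    (orthogonal B M ⊔ orthogonal B N).topologicalClosure ≤ orthogonal B (M ⊓ N) :=
  Submodule.topologicalClosure_minimal _
    (sup_le (orthogonal_anti inf_le_left) (orthogonal_anti inf_le_right)) (isClosed_orthogonal B _)

end Concordance

end HilbertModule

/-! ### The concordance criterion. -/

theorem theorem1p6 {B : Type u} [NonUnitalCStarAlgebra B] [PartialOrder B] [StarOrderedRing B]
    {X : Type v} [NormedAddCommGroup X] [NormedSpace ℂ X] [CompleteSpace X]
    [SMul Bᵐᵒᵖ X] [CStarModule Bᵐᵒᵖ X]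
    (M N : Submodule ℂ X)
    (hM : HilbertModule.IsComplemented B M) (hN : HilbertModule.IsComplemented B N) :
    HilbertModule.IsConcordant B M N ↔
      ∀ (H : Type (max u w)) [NormedAddCommGroup H] [InnerProductSpace ℂ H] [CompleteSpace H]
        (π : B →⋆ₙₐ[ℂ] (H →L[ℂ] H)), HilbertModule.IsIrreducible π →
        HilbertModule.locSubmodule π M ⊓ HilbertModule.locSubmodule π N =
          HilbertModule.locSubmodule π (M ⊓ N) := by
  open HilbertModule in
  have hMt := hM.isCompl.sup_eq_top
  have hNt := hN.isCompl.sup_eq_top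
  constructor
  · intro hC H _ _ _ π _
    refine le_antisymm ?_ (le_inf (locSubmodule_mono π inf_le_left)
      (locSubmodule_mono π inf_le_right))
    intro ξ hξ
    have : CompleteSpace (locSubmodule π (M ⊓ N)) :=
      (isClosed_locSubmodule π (M ⊓ N)).completeSpace_coe
    obtain ⟨a, ha, b, hb, rfl⟩ := (locSubmodule π (M ⊓ N)).exists_add_mem_mem_orthogonal ξ
    have hbM : b ∈ locSubmodule π M := by
      simpa using Submodule.sub_mem _ hξ.1 (locSubmodule_mono π inf_le_left ha)
    have hbN : b ∈ locSubmodule π N := by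
      simpa using Submodule.sub_mem _ hξ.2 (locSubmodule_mono π inf_le_right ha)
    -- `b` lies in `M_π ∩ N_π` and is orthogonal to `(M ∩ N)_π`, so `tmulOrthogonal π b` is a closed
    -- submodule containing `M ∩ N`, `Mᗮ` and `Nᗮ`.
    have hb0 : b = 0 := by
      refine eq_zero_of_tmulOrthogonal_eq_top π (top_le_iff.1 (hC.sup_eq_top ▸ sup_le
        ((le_tmulOrthogonal_iff π).2 hb) (Submodule.topologicalClosure_minimal _ (sup_le ?_ ?_)
        (isClosed_tmulOrthogonal π b))))
      · exact (le_tmulOrthogonal_iff π).2 (locSubmodule_orthogonal_le π M hbM)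
      · exact (le_tmulOrthogonal_iff π).2 (locSubmodule_orthogonal_le π N hbN)
    rwa [hb0, add_zero]
  · intro hloc
    have hPW := topologicalClosure_sup_le_orthogonal (B := B) M N
    have hPc : IsClosed ((M ⊓ N : Submodule ℂ X) : Set X) :=
      (isClosed_of_sup_orthogonal_eq_top hMt).inter (isClosed_of_sup_orthogonal_eq_top hNt)
    refine ⟨Submodule.disjoint_def.2 fun x hx hx' => ?_, codisjoint_iff.2 ?_⟩
    · exact (CStarModule.inner_self (A := Bᵐᵒᵖ)).1 (MulOpposite.unop_injective (hPW hx' x hx))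
    by_contra hne
    obtain ⟨H, _, _, _, π, hπ, hπZ⟩ := exists_irreducible_locSubmodule_ne_top.{u, v, w}
      (fun b x hx => act_mem_sup (B := B) (P := M ⊓ N)
        (fun b x hx => ⟨hM.act_mem b x hx.1, hN.act_mem b x hx.2⟩)
        (fun b x hx => act_mem_topologicalClosure (fun b x hx => act_mem_sup
          (fun b _ => act_mem_orthogonal M b) (fun b _ => act_mem_orthogonal N b) b hx) b hx) b hx)
      (isClosed_sup_of_orthogonal hPc (Submodule.isClosed_topologicalClosure _) hPW) hne
    apply hπZ
    have := (isClosed_locSubmodule π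
      (M ⊓ N ⊔ (orthogonal B M ⊔ orthogonal B N).topologicalClosure)).completeSpace_coe
    rw [← Submodule.orthogonal_eq_bot_iff, eq_bot_iff]
    intro b hb
    have hle := (le_tmulOrthogonal_iff π).2 hb
    have hW := (Submodule.le_topologicalClosure _).trans (le_sup_right.trans hle)
    have hbM : b ∈ locSubmodule π M := by
      rw [locSubmodule_eq_orthogonal π hMt, ← le_tmulOrthogonal_iff]
      exact le_sup_left.trans hW
    have hbN : b ∈ locSubmodule π N := by
      rw [locSubmodule_eq_orthogonal π hNt, ← le_tmulOrthogonal_iff]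
      exact le_sup_right.trans hW
    have hbMN : b ∈ locSubmodule π (M ⊓ N) := hloc H π hπ ▸ ⟨hbM, hbN⟩
    exact inner_self_eq_zero.1 ((le_tmulOrthogonal_iff π).1 (le_sup_left.trans hle) b hbMN)
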